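/- **Setting.** Let $\mathcal G=(\mathcal V,\mathcal E)$ be a finite directed acyclic graph, where an edge $e=(u,v)$ has tail $u$ and head $v$, and let $\mathcal S$ be a finite set of sources. The sets $a(s),b(s)\subseteq\mathcal V$, with $a(s)\cap b(s)=\emptyset$, are the nodes at which source $s$ is available and the nodes that demand it. The source symbols $(Y_s)_{s\in\mathcal S}$ take values in finite alphabets $\mathcal Y_s$ and have an arbitrary joint distribution; $(Y_s^n)_{s\in\mathcal S}$, $n=1,2,\dots$, are i.i.d. copies, and $Y_s^{(N)}=(Y_s^1,\dots,Y_s^N)$. For an edge $e$ with tail $u$, write $s\to e$ if $u\in a(s)$ and $f\to e$ if the edge $f$ has head $u$; for a node $u$, write $f\to u$ if $f$ has head $u$. All logarithms have the same base, and $H$ is Shannon entropy in that base. **Achievable region.** A network code of block length $N$ consists of finite message alphabets $\mathcal U_e^{(N)}$ and local encoding functions $\phi_e^{(N)}$ ($e\in\mathcal E$), which produce the message $U_e^{(N)}$ from $(Y_s^{(N)}: s\to e)$ and $(U_f^{(N)}: f\to e)$, and of decoding functions that produce, for $s\in\mathcal S$ and $u\in b(s)$, an estimate of $Y_s^{(N)}$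 from $(Y_{s'}^{(N)}: u\in a(s'))$ and $(U_f^{(N)}: f\to u)$. A link capacity tuple $\mathbf C=(C_e)_{e\in\mathcal E}$ is achievable if there is a sequence of network codes, indexed by $N$, such that $\lim_{N\to\infty}\frac1N\log|\mathcal U_e^{(N)}|$ exists and is at most $C_e$ for every $e\in\mathcal E$, and such that, for all $s\in\mathcal S$ and $u\in b(s)$, the probability that the estimate at $u$ differs from $Y_s^{(N)}$ tends to $0$. Let $\mathcal R_{\mathrm{cs}}$ be the set of all achievable tuples. **Set functions.** For a finite set $\mathcal Z$, a polymatroid on $\mathcal Z$ is a function $h:2^{\mathcal Z}\to\mathbb R$ with $h(\emptyset)=0$, $h(\alpha)\ge h(\beta)\ge 0$ for $\beta\subseteq\alpha$, and $h(\alpha)+h(\beta)\ge h(\alpha\cap\beta)+h(\alpha\cup\beta)$. Write $h(\alpha|\beta)=h(\alpha\cup\beta)-h(\beta)$. Let $\Gamma$ be the set of all polymatroids on the ground set in question, and let $\overline{\Gamma^*}$ be the set of all almost entropic functions, i.e. the closure in $\mathbb R^{2^{\mathcal Z}}$ of the set $\Gamma^*$ of all functions $\alpha\mapsto H(X_i,i\in\alpha)$,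 where $(X_i)_{i\in\mathcal Z}$ are jointly distributed random variables with finite alphabets. **Outer bounds.** For $\Delta\in\{\overline{\Gamma^*},\Gamma\}$ on the ground set $\mathcal S\cup\mathcal E$, let $\mathcal R_{\mathrm{cs}}(\Delta)$ be the set of all $\mathbf C\in\mathbb R^{\mathcal E}$ for which there is $h\in\Delta$ with $h(\alpha)=H(Y_s,s\in\alpha)$ for all $\alpha\subseteq\mathcal S$ and $$(\ast)\qquad h(e\,|\,f\in\mathcal S\cup\mathcal E: f\to e)=0,\qquad h(s\,|\,s'\in\mathcal S:u\in a(s'),\ f\in\mathcal E:f\to u)=0,\qquad h(e)\le C_e$$ for all $e\in\mathcal E$, $s\in\mathcal S$ and $u\in b(s)$. Let $\mathcal X\subseteq\prod_{s}\mathcal Y_s$ be the support of $Y=(Y_s)_{s\in\mathcal S}$, and let $\Omega$ be the set of all partitions $\langle\alpha\rangle=\{\alpha,\mathcal X\setminus\alpha\}$ of $\mathcal X$ into two nonempty parts. The binary partition random variable $A_{\langle\alpha\rangle}$ is the part of $\langle\alpha\rangle$ that contains $Y$. For $\Delta\in\{\overline{\Gamma^*},\Gamma\}$ on the ground set $\mathcal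 S\cup\mathcal E\cup\Omega$, let $\mathcal R'_{\mathrm{cs}}(\Delta)$ be the set of all $\mathbf C\in\mathbb R^{\mathcal E}$ for which there is $h\in\Delta$ with $h(\alpha\cup\beta)=H(Y_s,s\in\alpha,\ A_i,i\in\beta)$ for all $\alpha\subseteq\mathcal S$ and $\beta\subseteq\Omega$, and with $(\ast)$. (For $\Delta=\Gamma$ these are finitely many linear constraints on $h$ and $\mathbf C$, so $\mathcal R'_{\mathrm{cs}}(\Gamma)$ is an explicit linear programming bound.) **Corollary.** $$\mathcal R_{\mathrm{cs}}\subseteq\mathcal R'_{\mathrm{cs}}(\overline{\Gamma^*})\subseteq\mathcal R_{\mathrm{cs}}(\overline{\Gamma^*})\subseteq\mathcal R_{\mathrm{cs}}(\Gamma)\qquad\text{and}\qquad\mathcal R_{\mathrm{cs}}\subseteq\mathcal R'_{\mathrm{cs}}(\Gamma)\subseteq\mathcal R_{\mathrm{cs}}(\Gamma).$$ -/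

import Mathlib

open Filter Topology

namespace CorrelatedSources

noncomputable section

/-! ### Entropy and set functions -/

/-- Shannon entropy (natural logarithm) of a distribution on a finite set. -/
def entropy {α : Type*} (p : PMF α) : ℝ := ∑' a, Real.negMulLog (p a).toReal

/-- A set function `h : 𝒫(ι) → ℝ` is a polymatroid. -/
structure IsPolymatroid {ι : Type*} (h : Set ι → ℝ) : Prop where
  empty : h ∅ = 0
  nonneg : ∀ α, 0 ≤ h α
  mono : ∀ α β, β ⊆ α → h β ≤ h α
  submod : ∀ α β, h (α ∩ β) + h (α ∪ β) ≤ h α + h β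

/-- `Γ`: all polymatroids on the ground set `ι`. -/
def polymatroids (ι : Type*) : Set (Set ι → ℝ) := {h | IsPolymatroid h}

/-- `Γ*`: all entropy functions `α ↦ H(X_i, i ∈ α)` of families `(X_i)_{i ∈ ι}` of jointly
distributed random variables with finite alphabets (labelled `{0, …, k_i - 1}`). -/
def entropicFunctions (ι : Type*) : Set (Set ι → ℝ) :=
  {h | ∃ (k : ι → ℕ) (q : PMF (∀ i, Fin (k i))),
    ∀ α : Set ι, h α = entropy (q.map fun x (i : α) => x i)}

/-- The closure of `Γ*`: all almost entropic functions on `ι`. -/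
def almostEntropic (ι : Type*) : Set (Set ι → ℝ) := closure (entropicFunctions ι)

/-- `h(α | β) = h(α ∪ β) - h(β)`. -/
def condVal {ι : Type*} (h : Set ι → ℝ) (α β : Set ι) : ℝ := h (α ∪ β) - h β

/-! ### Networks -/

/-- A directed acyclic graph with vertices `V` and edges `E`, together with the sets `a s` of nodes
at which source `s` is available and the sets `b s` of nodes that demand source `s`. An edge `e`
goes from `tail e` to `head e`. -/
structure Network (V E S : Type*) where
  tail : E → V
  head : E → V
  acyclic : ∀ v, ¬ Relation.TransGen (fun u w => ∃ e, tail e = u ∧ head e = w) v v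
  a : S → Set V
  b : S → Set V
  disjoint : ∀ s, a s ∩ b s = ∅

namespace Network

variable {V E S : Type*} (G : Network V E S)

/-- The sources available at node `u`. -/
def srcAt (u : V) : Set S := {s | u ∈ G.a s}

/-- The edges entering node `u`. -/
def inEdges (u : V) : Set E := {f | G.head f = u}

/-- `f → e` for edges: the head of `f` is the tail of `e`. -/
def Feeds (f e : E) : Prop := f ∈ G.inEdges (G.tail e)

theorem wellFounded_feeds [Finite E] : WellFounded G.Feeds := by
  have hstep : ∀ f e, G.Feeds f e → ∃ g, G.tail g = G.tail f ∧ G.head g = G.tail e :=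
    fun f e hfe => ⟨f, rfl, hfe⟩
  have hpath : ∀ f e, Relation.TransGen G.Feeds f e → Relation.TransGen
      (fun u w => ∃ g, G.tail g = u ∧ G.head g = w) (G.tail f) (G.tail e) := fun f e h => by
    induction h with
    | single h => exact .single (hstep _ _ h)
    | tail _ h ih => exact ih.tail (hstep _ _ h)
  have hirr : ∀ e, ¬ Relation.TransGen G.Feeds e e := fun e h => G.acyclic _ (hpath e e h)
  have : Std.Irrefl (Relation.TransGen G.Feeds) := ⟨hirr⟩
  exact Subrelation.wf (fun h => Relation.TransGen.single h)
    (Finite.wellFounded_of_trans_of_irrefl (Relation.TransGen G.Feeds))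

end Network

/-- A network code over blocks of `N` source symbols: message alphabets of sizes `card e`, local
encoding functions and decoding functions. -/
structure NetworkCode {V E S : Type*} (G : Network V E S) (𝒴 : S → Type*) (N : ℕ) where
  card : E → ℕ
  enc : ∀ e : E, (∀ s : G.srcAt (G.tail e), Fin N → 𝒴 s) →
    (∀ f : G.inEdges (G.tail e), Fin (card f)) → Fin (card e)
  dec : ∀ s : S, ∀ u ∈ G.b s, (∀ s' : G.srcAt u, Fin N → 𝒴 s') →
    (∀ f : G.inEdges u, Fin (card f)) → (Fin N → 𝒴 s)

namespace NetworkCode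

variable {V E S : Type*} [Finite E] {G : Network V E S} {𝒴 : S → Type*} {N : ℕ}
  (φ : NetworkCode G 𝒴 N)

/-- The message `U_e` on edge `e` when the sources emit the block `y`, obtained by applying the
local encoding functions along the acyclic graph. -/
def msg (y : Fin N → ∀ s, 𝒴 s) : ∀ e, Fin (φ.card e) :=
  G.wellFounded_feeds.fix fun e ih => φ.enc e (fun s n => y n s) (fun f => ih f f.2)

theorem msg_eq (y : Fin N → ∀ s, 𝒴 s) (e : E) :
    φ.msg y e = φ.enc e (fun s n => y n s) (fun f => φ.msg y f) :=
  WellFounded.fix_eq _ _ _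

/-- The reproduction of source `s` at a node `u` that demands it. -/
def decoded (y : Fin N → ∀ s, 𝒴 s) (s : S) (u : V) (hu : u ∈ G.b s) : Fin N → 𝒴 s :=
  φ.dec s u hu (fun s' n => y n s') (fun f => φ.msg y f)

end NetworkCode

/-- The law of `N` independent copies of a random variable with law `p`. -/
def iidLaw {α : Type*} [Finite α] (p : PMF α) (N : ℕ) : PMF (Fin N → α) :=
  ⟨fun y => ∏ n, p (y n), by
    classical
    have := Fintype.ofFinite α
    have h : ∑ y : Fin N → α, ∏ n, p (y n) = 1 := by
      rw [← Fintype.piFinset_univ, ← Finset.prod_univ_sum]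
      have h1 : ∑ a, p a = 1 := by rw [← tsum_fintype (L := .unconditional _)]; exact p.tsum_coe
      simp [h1]
    rw [← h]
    exact hasSum_fintype _⟩

section Regions

variable {V E S : Type*} [Finite E] [Finite S] (G : Network V E S)
  {𝒴 : S → Type*} [∀ s, Finite (𝒴 s)] (p : PMF (∀ s, 𝒴 s))

/-- The probability that the sink `u` does not reproduce the block of source `s`. -/
def errorProb {N : ℕ} (φ : NetworkCode G 𝒴 N) (s : S) (u : V) (hu : u ∈ G.b s) : ENNReal :=
  (iidLaw p N).toOuterMeasure {y | φ.decoded y s u hu ≠ fun n => y n s}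

/-- `R_cs`: the set of all achievable link capacity tuples. -/
def achievableRegion : Set (E → ℝ) :=
  {C | ∃ φ : ∀ N : ℕ, NetworkCode G 𝒴 N,
    (∀ e, ∃ r, Tendsto (fun N : ℕ => Real.log ((φ N).card e) / N) atTop (𝓝 r) ∧ r ≤ C e) ∧
    ∀ s u (hu : u ∈ G.b s), Tendsto (fun N => errorProb G p (φ N) s u hu) atTop (𝓝 0)}

end Regions

section OuterBounds

variable {V E S : Type*} (G : Network V E S) {𝒴 : S → Type*} (p : PMF (∀ s, 𝒴 s))

/-- The encoding, decoding and capacity constraints on a set function `h`, on a ground set in which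
the sources and the edges are found through `src` and `lnk`. -/
structure NetworkConstraints {ι : Type*} (src : S → ι) (lnk : E → ι) (h : Set ι → ℝ)
    (C : E → ℝ) : Prop where
  encoding : ∀ e, condVal h {lnk e}
    (src '' G.srcAt (G.tail e) ∪ lnk '' G.inEdges (G.tail e)) = 0
  decoding : ∀ s, ∀ u ∈ G.b s, condVal h {src s} (src '' G.srcAt u ∪ lnk '' G.inEdges u) = 0
  capacity : ∀ e, h {lnk e} ≤ C e

/-- `R_cs(Δ)`, for a set `Δ` of set functions on `S ∪ E`. -/
def outerRegion (Δ : Set (Set (S ⊕ E) → ℝ)) : Set (E → ℝ) :=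
  {C | ∃ h ∈ Δ,
    (∀ α : Set S, h (Sum.inl '' α) - entropy (p.map fun y (s : α) => y s) = 0) ∧
    NetworkConstraints G Sum.inl Sum.inr h C}

/-- The binary partitions `⟨α⟩ = {α, αᶜ}` of a set `T` into two nonempty parts. -/
def BinPartition {X : Type*} (T : Set X) : Type _ :=
  {P : Set (Set X) // ∃ α ⊆ T, α.Nonempty ∧ (T \ α).Nonempty ∧ P = {α, T \ α}}

/-- The binary partition variable `A_⟨α⟩`: the part of the partition that contains the outcome `y`
(see `partitionVar_of_mem` and `partitionVar_of_not_mem`; outcomes outside `T` do not matter, as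
`T` will be the support of the distribution). -/
def partitionVar {X : Type*} {T : Set X} (P : BinPartition T) (y : X) : Set X :=
  ⋂₀ {B | B ∈ P.1 ∧ y ∈ B}

theorem partitionVar_of_mem {X : Type*} {T : Set X} (P : BinPartition T) {α : Set X}
    (hP : P.1 = {α, T \ α}) {y : X} (hy : y ∈ α) : partitionVar P y = α := by
  have h : {B | B ∈ P.1 ∧ y ∈ B} = {α} := by
    ext B
    simp only [hP, Set.mem_insert_iff, Set.mem_singleton_iff, Set.mem_ofPred_eq]
    constructor
    · rintro ⟨rfl | rfl, hB⟩
      · rfl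
      · exact absurd hy hB.2
    · rintro rfl
      exact ⟨Or.inl rfl, hy⟩
  rw [partitionVar, h, Set.sInter_singleton]

theorem partitionVar_of_not_mem {X : Type*} {T : Set X} (P : BinPartition T) {α : Set X}
    (hP : P.1 = {α, T \ α}) {y : X} (hyT : y ∈ T) (hy : y ∉ α) :
    partitionVar P y = T \ α := by
  have h : {B | B ∈ P.1 ∧ y ∈ B} = {T \ α} := by
    ext B
    simp only [hP, Set.mem_insert_iff, Set.mem_singleton_iff, Set.mem_ofPred_eq]
    constructor
    · rintro ⟨rfl | rfl, hB⟩
      · exact absurd hB hy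
      · rfl
    · rintro rfl
      exact ⟨Or.inr rfl, hyT, hy⟩
  rw [partitionVar, h, Set.sInter_singleton]

/-- `R'_cs(Δ)`, for a set `Δ` of set functions on `S ∪ E ∪ Ω`, where `Ω` is the set of all binary
partitions of the support of the joint source distribution. -/
def partitionRegion (Δ : Set (Set (S ⊕ E ⊕ BinPartition p.support) → ℝ)) : Set (E → ℝ) :=
  {C | ∃ h ∈ Δ,
    (∀ (α : Set S) (β : Set (BinPartition p.support)),
      h (Sum.inl '' α ∪ (Sum.inr ∘ Sum.inr) '' β) -
        entropy (p.map fun y => ((fun s : α => y s), (fun i : β => partitionVar i.1 y))) = 0) ∧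
    NetworkConstraints G Sum.inl (Sum.inr ∘ Sum.inl) h C}

end OuterBounds

end

end CorrelatedSources

namespace CorrelatedSources

noncomputable section

/-! Entropy sees a random variable on a finite probability space only through its kernel. So
variables are treated as equivalence relations on the sample space: joint variables are infima, and
"is a function of" is `≤`. For the converse, take the joint entropies of the source blocks, the
messages and the partition-variable blocks of the `N`-th code, divided by `N`. All these variables
are functions of the source block, so the values lie in `[0, H(Y)]`, and compactness gives a
subsequential limit `h`. The source and partition values are exact for `N > 0` by additivity over
i.i.d. copies (`setoidEntropy_pow`), and the encoding equalities are exact for every `N`. The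
decoding equalities hold in the limit by `fano`, and the capacities follow from
`setoidEntropy_ker_le_log_card`. The factor `1/N` preserves almost entropic functions by
`smul_setoidEntropy_mem_almostEntropic`. The remaining inclusions restrict `h` to the smaller ground
set or use that almost entropic functions are polymatroids (`setoidEntropy_submod` and closedness of
the polymatroid inequalities). -/

open scoped Classical in
/-- The mass of the class of `ω` under the equivalence relation `r`. -/
def classMass {Ω : Type*} [Fintype Ω] (w : Ω → ℝ) (r : Setoid Ω) (ω : Ω) : ℝ :=
  ∑ ω', if r ω' ω then w ω' else 0

/-- The Shannon entropy of the quotient of a finite weighted set by an equivalence relation. -/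
def setoidEntropy {Ω : Type*} [Fintype Ω] (w : Ω → ℝ) (r : Setoid Ω) : ℝ :=
  ∑ ω, w ω * -Real.log (classMass w r ω)

/-- `w` is a probability distribution on `Ω`. -/
structure IsProbWeight {Ω : Type*} [Fintype Ω] (w : Ω → ℝ) : Prop where
  nonneg : ∀ ω, 0 ≤ w ω
  sum_eq : ∑ ω, w ω = 1

/-! ### Entropy inequalities on a finite weighted set. -/

section Basic

variable {Ω : Type*} [Fintype Ω] {w : Ω → ℝ}

theorem le_classMass (hw : ∀ ω, 0 ≤ w ω) (r : Setoid Ω) (ω : Ω) : w ω ≤ classMass w r ω := by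
  classical
  have h := Finset.single_le_sum (f := fun ω' => if r ω' ω then w ω' else 0)
    (fun ω' _ => by split_ifs <;> simp [hw]) (Finset.mem_univ ω)
  simpa [classMass, r.refl ω] using h

theorem classMass_nonneg (hw : ∀ ω, 0 ≤ w ω) (r : Setoid Ω) (ω : Ω) : 0 ≤ classMass w r ω :=
  (hw ω).trans (le_classMass hw r ω)

theorem classMass_mono (hw : ∀ ω, 0 ≤ w ω) {r t : Setoid Ω} (h : r ≤ t) (ω : Ω) :
    classMass w r ω ≤ classMass w t ω := by
  classical
  refine Finset.sum_le_sum fun ω' _ => ?_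
  by_cases h1 : r ω' ω
  · simp [h1, h h1]
  · rw [if_neg h1]; split_ifs <;> simp [hw]

theorem classMass_top (hw : IsProbWeight w) (ω : Ω) : classMass w ⊤ ω = 1 := by
  rw [classMass, ← hw.sum_eq]
  exact Finset.sum_congr rfl fun _ _ => if_pos trivial

theorem classMass_le_one (hw : IsProbWeight w) (r : Setoid Ω) (ω : Ω) : classMass w r ω ≤ 1 :=
  (classMass_mono hw.nonneg le_top ω).trans_eq (classMass_top hw ω)

theorem classMass_congr (w : Ω → ℝ) {r : Setoid Ω} {ω ω' : Ω} (h : r ω ω') :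
    classMass w r ω = classMass w r ω' := by
  classical
  refine Finset.sum_congr rfl fun x _ => ?_
  have : r x ω ↔ r x ω' := ⟨fun h1 => r.trans h1 h, fun h1 => r.trans h1 (r.symm h)⟩
  exact if_congr this rfl rfl

theorem setoidEntropy_nonneg (hw : IsProbWeight w) (r : Setoid Ω) : 0 ≤ setoidEntropy w r :=
  Finset.sum_nonneg fun ω _ => mul_nonneg (hw.nonneg ω) <| neg_nonneg.2 <|
    Real.log_nonpos (classMass_nonneg hw.nonneg r ω) (classMass_le_one hw r ω)

theorem setoidEntropy_top (hw : IsProbWeight w) : setoidEntropy w ⊤ = 0 := by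
  simp [setoidEntropy, classMass_top hw]

theorem setoidEntropy_anti (hw : ∀ ω, 0 ≤ w ω) {r t : Setoid Ω} (h : r ≤ t) :
    setoidEntropy w t ≤ setoidEntropy w r := by
  refine Finset.sum_le_sum fun ω _ => ?_
  rcases (hw ω).eq_or_lt with h0 | h0
  · simp [← h0]
  · exact mul_le_mul_of_nonneg_left (neg_le_neg (Real.log_le_log
      (h0.trans_le (le_classMass hw r ω)) (classMass_mono hw h ω))) h0.le

/-- Jensen's inequality for `log`, via `log x ≤ x - 1`. The entropy inequalities below reduce to it
by choosing `x`. -/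
theorem sum_mul_log_nonpos (hw : IsProbWeight w) {x : Ω → ℝ} (hx : ∀ ω, 0 < w ω → 0 < x ω)
    (h : ∑ ω, w ω * x ω ≤ 1) : ∑ ω, w ω * Real.log (x ω) ≤ 0 := by
  have h1 : ∑ ω, w ω * Real.log (x ω) ≤ ∑ ω, (w ω * x ω - w ω) := by
    refine Finset.sum_le_sum fun ω _ => ?_
    rcases (hw.nonneg ω).eq_or_lt with h0 | h0
    · simp [← h0]
    · have := mul_le_mul_of_nonneg_left (Real.log_le_sub_one_of_pos (hx ω h0)) h0.le
      linarith
  rw [Finset.sum_sub_distrib, hw.sum_eq] at h1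
  linarith

-- The sum is the mass of one class divided by itself. It is `0` rather than `1` for a null class,
-- since `0 / 0 = 0`.
open scoped Classical in
theorem sum_class_div_le_one (w : Ω → ℝ) (r : Setoid Ω) (x : Ω) :
    ∑ ω, (if r ω x then w ω / classMass w r ω else 0) ≤ 1 := by
  have : ∑ ω, (if r ω x then w ω / classMass w r ω else 0)
      = classMass w r x / classMass w r x := by
    rw [classMass, Finset.sum_div]
    refine Finset.sum_congr rfl fun ω _ => ?_
    split_ifs with h
    · rw [classMass_congr w h]; rfl
    · simp
  rw [this]
  exact div_self_le_one _

/-- The relation `t` need not be the join of `r` and `s`: for polymatroids it is the infimum over `α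
∩ β`, which is only an upper bound of the infima over `α` and over `β`. -/
theorem setoidEntropy_submod (hw : IsProbWeight w) {r s t : Setoid Ω} (hr : r ≤ t) (hs : s ≤ t) :
    setoidEntropy w t + setoidEntropy w (r ⊓ s) ≤ setoidEntropy w r + setoidEntropy w s := by
  classical
  have hw0 := hw.nonneg
  have hpos : ∀ (q : Setoid Ω) ω, 0 < w ω → 0 < classMass w q ω :=
    fun q ω h => h.trans_le (le_classMass hw0 q ω)
  -- The mean of `log x` is the left side of the claim minus the right side, so it suffices that `x`
  -- has mean at most `1`.
  set x : Ω → ℝ := fun ω => classMass w r ω * classMass w s ω /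
    (classMass w t ω * classMass w (r ⊓ s) ω) with hx
  have key : ∑ ω, w ω * x ω ≤ 1 := by
    have e1 : ∀ ω, w ω * x ω = ∑ a, ∑ b, (w a * w b) * (if r a ω ∧ s b ω then
        w ω / classMass w (r ⊓ s) ω / classMass w t ω else 0) := fun ω => by
      have : w ω * x ω = classMass w r ω * classMass w s ω *
        (w ω / classMass w (r ⊓ s) ω / classMass w t ω) := by
          simp only [hx]; rw [div_div, mul_comm (classMass w t ω)]; ring
      rw [this]
      conv_lhs => rw [classMass, classMass, Finset.sum_mul_sum, Finset.sum_mul]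
      refine Finset.sum_congr rfl fun a _ => ?_
      rw [Finset.sum_mul]
      refine Finset.sum_congr rfl fun b _ => ?_
      by_cases h1 : r a ω <;> by_cases h2 : s b ω <;> simp [h1, h2]
    -- The `ω` that are `r`-related to `a` and `s`-related to `b` form a single class of `r ⊓ s` or
    -- none, and they lie in the `t`-class of `a`.
    have e2 : ∀ a b, ∑ ω, (if r a ω ∧ s b ω then
        w ω / classMass w (r ⊓ s) ω / classMass w t ω else 0) ≤
          if t b a then (classMass w t a)⁻¹ else 0 := fun a b => by
      by_cases hex : ∃ ω, r a ω ∧ s b ω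
      · obtain ⟨x, hax, hbx⟩ := hex
        rw [if_pos (t.trans (hs hbx) (t.symm (hr hax)))]
        calc _ = (∑ ω, if (r ⊓ s) ω x then w ω / classMass w (r ⊓ s) ω else 0) *
              (classMass w t a)⁻¹ := by
              rw [Finset.sum_mul]
              refine Finset.sum_congr rfl fun ω _ => ?_
              have hiff : (r a ω ∧ s b ω) ↔ (r ⊓ s) ω x := by
                change _ ↔ r ω x ∧ s ω x
                exact ⟨fun h => ⟨r.trans (r.symm h.1) hax, s.trans (s.symm h.2) hbx⟩,
                  fun h => ⟨r.trans hax (r.symm h.1), s.trans hbx (s.symm h.2)⟩⟩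
              by_cases h : r a ω ∧ s b ω
              · rw [if_pos h, if_pos (hiff.1 h), classMass_congr w (hr h.1), div_eq_mul_inv]
              · rw [if_neg h, if_neg (fun h' => h (hiff.2 h')), zero_mul]
          _ ≤ _ := mul_le_of_le_one_left (inv_nonneg.2 (classMass_nonneg hw0 t a))
              (sum_class_div_le_one w _ x)
      · rw [Finset.sum_eq_zero fun ω _ => if_neg fun h => hex ⟨ω, h⟩]
        split_ifs
        · exact inv_nonneg.2 (classMass_nonneg hw0 t a)
        · exact le_rfl
    calc ∑ ω, w ω * x ω = ∑ a, ∑ b, (w a * w b) * ∑ ω, (if r a ω ∧ s b ω then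
        w ω / classMass w (r ⊓ s) ω / classMass w t ω else 0) := by
          simp_rw [e1, Finset.mul_sum]
          rw [Finset.sum_comm]
          exact Finset.sum_congr rfl fun a _ => Finset.sum_comm
      _ ≤ ∑ a, ∑ b, (w a * w b) * (if t b a then (classMass w t a)⁻¹ else 0) :=
          Finset.sum_le_sum fun a _ => Finset.sum_le_sum fun b _ =>
            mul_le_mul_of_nonneg_left (e2 a b) (mul_nonneg (hw0 a) (hw0 b))
      _ = ∑ a, w a * (classMass w t a * (classMass w t a)⁻¹) := by
          refine Finset.sum_congr rfl fun a _ => ?_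
          conv_rhs => rw [classMass, Finset.sum_mul, Finset.mul_sum]
          refine Finset.sum_congr rfl fun b _ => ?_
          split_ifs <;> simp [classMass, mul_assoc]
      _ ≤ ∑ a, w a := Finset.sum_le_sum fun a _ =>
          mul_le_of_le_one_right (hw0 a) mul_inv_le_one
      _ = 1 := hw.sum_eq
  have := sum_mul_log_nonpos hw (x := x) (fun ω h => by
    have := hpos r ω h; have := hpos s ω h; have := hpos t ω h; have := hpos (r ⊓ s) ω h
    positivity) key
  have e : ∑ ω, w ω * Real.log (x ω) = setoidEntropy w t + setoidEntropy w (r ⊓ s) -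
      (setoidEntropy w r + setoidEntropy w s) := by
    simp only [setoidEntropy, ← Finset.sum_add_distrib, ← Finset.sum_sub_distrib]
    refine Finset.sum_congr rfl fun ω _ => ?_
    rcases (hw0 ω).eq_or_lt with h0 | h0
    · simp [← h0]
    · have h1 := (hpos r ω h0).ne'; have h2 := (hpos s ω h0).ne'
      have h3 := (hpos t ω h0).ne'; have h4 := (hpos (r ⊓ s) ω h0).ne'
      simp only [hx]
      rw [Real.log_div (mul_ne_zero h1 h2) (mul_ne_zero h3 h4), Real.log_mul h1 h2,
        Real.log_mul h3 h4]
      ring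
  linarith

/-- The conditional entropy of `X` is at most its cross entropy with any conditional
subdistribution. -/
theorem setoidEntropy_ker_inf_le (hw : IsProbWeight w) {A : Type*} [Fintype A] (X : Ω → A)
    (z : Setoid Ω) (q : A → Ω → ℝ) (hq : ∀ a ω, 0 < q a ω)
    (hqz : ∀ a ω ω', z ω ω' → q a ω = q a ω') (hq1 : ∀ ω, ∑ a, q a ω ≤ 1) :
    setoidEntropy w (Setoid.ker X ⊓ z) - setoidEntropy w z ≤
      ∑ ω, w ω * -Real.log (q (X ω) ω) := by
  classical
  have hw0 := hw.nonneg
  have hpos : ∀ (q : Setoid Ω) ω, 0 < w ω → 0 < classMass w q ω :=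
    fun q ω h => h.trans_le (le_classMass hw0 q ω)
  set r := Setoid.ker X ⊓ z with hr
  set x : Ω → ℝ := fun ω => q (X ω) ω * classMass w z ω / classMass w r ω with hx
  -- Split by the value `a` of `X`: inside the `z`-class of `b`, the outcomes with `X = a` form one
  -- class of `r` or none, and `q a` is constant there.
  have inner : ∀ b, ∑ ω, (if z b ω then q (X ω) ω * (w ω / classMass w r ω) else 0) ≤ 1 := by
    intro b
    calc ∑ ω, (if z b ω then q (X ω) ω * (w ω / classMass w r ω) else 0)
        = ∑ a, q a b * ∑ ω, (if X ω = a ∧ z b ω then w ω / classMass w r ω else 0) := by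
          simp_rw [Finset.mul_sum]
          rw [Finset.sum_comm]
          refine Finset.sum_congr rfl fun ω _ => ?_
          by_cases h : z b ω
          · simp only [h, if_true, and_true]
            rw [Finset.sum_eq_single (X ω) (fun a _ ha => by rw [if_neg ha.symm, mul_zero])
              (by simp)]
            rw [if_pos rfl, hqz _ _ _ h]
          · simp [h]
      _ ≤ ∑ a, q a b * 1 := by
          refine Finset.sum_le_sum fun a _ => mul_le_mul_of_nonneg_left ?_ (hq a b).le
          by_cases hex : ∃ ω, X ω = a ∧ z b ω
          · obtain ⟨c, hc, hbc⟩ := hex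
            refine le_trans (le_of_eq ?_) (sum_class_div_le_one w r c)
            refine Finset.sum_congr rfl fun ω _ => ?_
            have hiff : (X ω = a ∧ z b ω) ↔ r ω c := by
              change _ ↔ X ω = X c ∧ z ω c
              rw [hc]
              exact and_congr_right fun _ =>
                ⟨fun h => z.trans (z.symm h) hbc, fun h => z.trans hbc (z.symm h)⟩
            simp only [hiff]
          · rw [Finset.sum_eq_zero fun ω _ => if_neg fun h => hex ⟨ω, h⟩]
            exact zero_le_one
      _ ≤ 1 := by simpa using hq1 b
  have key : ∑ ω, w ω * x ω ≤ 1 := by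
    calc ∑ ω, w ω * x ω
        = ∑ b, w b * ∑ ω, (if z b ω then q (X ω) ω * (w ω / classMass w r ω) else 0) := by
          simp_rw [Finset.mul_sum]
          rw [Finset.sum_comm]
          refine Finset.sum_congr rfl fun ω _ => ?_
          have : w ω * x ω = classMass w z ω * (q (X ω) ω * (w ω / classMass w r ω)) := by
            simp only [hx]; ring
          rw [this]
          conv_lhs => rw [classMass, Finset.sum_mul]
          refine Finset.sum_congr rfl fun b _ => ?_
          by_cases h : z b ω <;> simp [h]
      _ ≤ ∑ b, w b * 1 := Finset.sum_le_sum fun b _ =>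
          mul_le_mul_of_nonneg_left (inner b) (hw0 b)
      _ = 1 := by simp [hw.sum_eq]
  have := sum_mul_log_nonpos hw (x := x) (fun ω h => by
    have := hpos r ω h; have := hpos z ω h; have := hq (X ω) ω
    positivity) key
  have e : ∑ ω, w ω * Real.log (x ω) = setoidEntropy w r - setoidEntropy w z -
      ∑ ω, w ω * -Real.log (q (X ω) ω) := by
    simp only [setoidEntropy, ← Finset.sum_sub_distrib]
    refine Finset.sum_congr rfl fun ω _ => ?_
    rcases (hw0 ω).eq_or_lt with h0 | h0
    · simp [← h0]
    · have h1 := (hpos r ω h0).ne'; have h2 := (hpos z ω h0).ne'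
      have h3 := (hq (X ω) ω).ne'
      simp only [hx]
      rw [Real.log_div (mul_ne_zero h3 h2) h1, Real.log_mul h3 h2]
      ring
  linarith

theorem setoidEntropy_ker_le_log_card (hw : IsProbWeight w) {A : Type*} [Fintype A] (X : Ω → A) :
    setoidEntropy w (Setoid.ker X) ≤ Real.log (Fintype.card A) := by
  by_cases hA : Nonempty A
  · have hpos : (0 : ℝ) < Fintype.card A := by exact_mod_cast Fintype.card_pos
    -- Cross entropy with the uniform distribution, under trivial conditioning.
    have h := setoidEntropy_ker_inf_le hw X ⊤ (fun _ _ => (Fintype.card A : ℝ)⁻¹)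
      (fun _ _ => by positivity) (fun _ _ _ _ => rfl) (fun _ => by simp [hpos.ne'])
    rw [inf_top_eq, setoidEntropy_top hw, sub_zero, ← Finset.sum_mul, hw.sum_eq] at h
    simpa using h
  · have : IsEmpty Ω := ⟨fun ω => hA ⟨X ω⟩⟩
    have := hw.sum_eq
    simp at this

/-- Fano's inequality. -/
theorem fano (hw : IsProbWeight w) {A : Type*} [Fintype A] (X Xhat : Ω → A)
    (z : Setoid Ω) (hz : z ≤ Setoid.ker Xhat) :
    setoidEntropy w (Setoid.ker X ⊓ z) - setoidEntropy w z ≤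
      Real.log 2 + (∑ ω, {ω | Xhat ω ≠ X ω}.indicator w ω) * Real.log (Fintype.card A) := by
  classical
  have hA : Nonempty A := by
    by_contra hA
    have : IsEmpty Ω := ⟨fun ω => hA ⟨X ω⟩⟩
    have := hw.sum_eq
    simp at this
  have hpos : (0 : ℝ) < Fintype.card A := by exact_mod_cast Fintype.card_pos
  -- Half of the mass is put on the estimate and half is spread uniformly over `A`. A correct
  -- estimate costs `log 2`, a wrong one `log 2 + log |A|`.
  refine (setoidEntropy_ker_inf_le hw X z
    (fun a ω => if Xhat ω = a then 2⁻¹ else 2⁻¹ * (Fintype.card A : ℝ)⁻¹) (fun a ω => by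
      split_ifs <;> positivity) (fun a ω ω' h => by rw [show Xhat ω = Xhat ω' from hz h])
      (fun ω => ?_)).trans (le_of_eq ?_)
  · calc _ ≤ ∑ a, ((if Xhat ω = a then 2⁻¹ else 0) + 2⁻¹ * (Fintype.card A : ℝ)⁻¹) := by
          refine Finset.sum_le_sum fun a _ => ?_
          split_ifs
          · exact le_add_of_nonneg_right (by positivity)
          · simp
      _ = 1 := by
          rw [Finset.sum_add_distrib]
          simp
          field_simp
          norm_num
  · rw [Finset.sum_mul, ← one_mul (Real.log 2), ← hw.sum_eq, Finset.sum_mul,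
      ← Finset.sum_add_distrib]
    refine Finset.sum_congr rfl fun ω _ => ?_
    by_cases h : Xhat ω = X ω
    · simp [h]
    · rw [if_neg h, Set.indicator_of_mem (by exact h)]
      rw [Real.log_mul (by norm_num) (inv_ne_zero hpos.ne'), Real.log_inv, Real.log_inv]
      ring

end Basic

/-! ### Entropy of a distribution as entropy of a kernel. -/

section PMF

variable {Ω : Type*} [Fintype Ω]

theorem isProbWeight_toReal (p : PMF Ω) : IsProbWeight fun ω => (p ω).toReal where
  nonneg _ := ENNReal.toReal_nonneg
  sum_eq := by
    rw [← ENNReal.toReal_sum fun ω _ => p.apply_ne_top ω, ← tsum_fintype (L := .unconditional _),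
      p.tsum_coe, ENNReal.toReal_one]

/-- Grouping the outcomes by the value of `f` turns one sum into the other. `A` may be infinite,
because only the finite image of `f` contributes. -/
theorem entropy_map_eq {A : Type*} (p : PMF Ω) (f : Ω → A) :
    entropy (p.map f) = setoidEntropy (fun ω => (p ω).toReal) (Setoid.ker f) := by
  classical
  have hm : ∀ a, ((p.map f) a).toReal = ∑ ω, if f ω = a then (p ω).toReal else 0 := fun a => by
    rw [PMF.map_apply, tsum_fintype, ENNReal.toReal_sum]
    · refine Finset.sum_congr rfl fun ω _ => ?_
      by_cases h : f ω = a
      · simp [h]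
      · rw [if_neg h, if_neg (Ne.symm h), ENNReal.toReal_zero]
    · intro ω _
      split_ifs
      · exact p.apply_ne_top ω
      · exact ENNReal.zero_ne_top
  have hc : ∀ ω, ((p.map f) (f ω)).toReal =
      classMass (fun ω => (p ω).toReal) (Setoid.ker f) ω := fun ω => by
    rw [hm, classMass]
    refine Finset.sum_congr rfl fun ω' _ => ?_
    simp only [Setoid.ker_def]
  rw [entropy, tsum_eq_sum (s := Finset.univ.image f)]
  · rw [setoidEntropy, ← Finset.sum_fiberwise_of_maps_to
      (fun ω _ => Finset.mem_image_of_mem f (Finset.mem_univ ω))]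
    refine Finset.sum_congr rfl fun a _ => ?_
    rw [Real.negMulLog, neg_mul, ← mul_neg]
    nth_rw 1 [hm a]
    rw [← Finset.sum_filter, Finset.sum_mul]
    refine Finset.sum_congr rfl fun ω hω => ?_
    rw [← hc, (Finset.mem_filter.1 hω).2]
  · intro a ha
    rw [hm, Finset.sum_eq_zero, Real.negMulLog_zero]
    intro ω _
    exact if_neg fun h => ha (Finset.mem_image.2 ⟨ω, Finset.mem_univ ω, h⟩)

theorem exists_pmf_toReal {w : Ω → ℝ} (hw : IsProbWeight w) :
    ∃ p : PMF Ω, (fun ω => (p ω).toReal) = w := by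
  refine ⟨PMF.ofFintype (fun ω => ENNReal.ofReal (w ω)) ?_, ?_⟩
  · rw [← ENNReal.ofReal_sum_of_nonneg fun ω _ => hw.nonneg ω, hw.sum_eq, ENNReal.ofReal_one]
  · funext ω
    rw [PMF.ofFintype_apply, ENNReal.toReal_ofReal (hw.nonneg ω)]

end PMF

theorem iInf_rel {Ω : Type*} {ι : Sort*} {r : ι → Setoid Ω} {x y : Ω} :
    (⨅ i, r i) x y ↔ ∀ i, r i x y := by
  change (∀ t ∈ Set.range r, t x y) ↔ _
  simp

theorem ker_restrict {Ω ι : Type*} {β : ι → Type*} (f : ∀ i, Ω → β i) (α : Set ι) :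
    Setoid.ker (fun ω (i : α) => f i ω) = ⨅ i ∈ α, Setoid.ker (f i) := by
  ext x y
  simp only [iInf_rel, Setoid.ker_def, funext_iff, Subtype.forall]

/-! ### Entropic functions, polymatroids and change of ground set. -/

section Entropic

variable {Ω ι : Type*} [Fintype Ω] {w : Ω → ℝ}

/-- Numbering the classes of `r i` gives a variable with finite alphabet and kernel `r i`. -/
theorem setoidEntropy_mem_entropicFunctions (hw : IsProbWeight w) (r : ι → Setoid Ω) :
    (fun α : Set ι => setoidEntropy w (⨅ i ∈ α, r i)) ∈ entropicFunctions ι := by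
  obtain ⟨p, rfl⟩ := exists_pmf_toReal hw
  let f : ∀ i, Ω → Fin (Nat.card (Quotient (r i))) := fun i ω =>
    Finite.equivFin (Quotient (r i)) (Quotient.mk (r i) ω)
  have hf : ∀ i, Setoid.ker (f i) = r i := fun i => by
    ext x y
    simp [f, Setoid.ker_def, Quotient.eq]
  refine ⟨_, p.map fun ω i => f i ω, fun α => ?_⟩
  rw [PMF.map_comp]
  change _ = entropy (p.map fun ω (i : α) => f i ω)
  rw [entropy_map_eq, ker_restrict]
  simp only [hf]

theorem exists_setoidEntropy_eq.{u} {ι : Type u} [Finite ι] {h : Set ι → ℝ}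
    (hh : h ∈ entropicFunctions ι) :
    ∃ (Ω : Type u) (_ : Fintype Ω) (w : Ω → ℝ) (r : ι → Setoid Ω), IsProbWeight w ∧
      ∀ α, h α = setoidEntropy w (⨅ i ∈ α, r i) := by
  obtain ⟨k, q, hq⟩ := hh
  have := Fintype.ofFinite (∀ i, Fin (k i))
  refine ⟨∀ i, Fin (k i), this, fun x => (q x).toReal, fun i => Setoid.ker fun x => x i,
    isProbWeight_toReal q, fun α => ?_⟩
  rw [hq, entropy_map_eq, ker_restrict fun i (x : ∀ i, Fin (k i)) => x i]

theorem isPolymatroid_setoidEntropy (hw : IsProbWeight w) (r : ι → Setoid Ω) :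
    IsPolymatroid fun α : Set ι => setoidEntropy w (⨅ i ∈ α, r i) where
  empty := by simp [setoidEntropy_top hw]
  nonneg α := setoidEntropy_nonneg hw _
  mono α β h := setoidEntropy_anti hw.nonneg (biInf_mono h)
  submod α β := by
    rw [iInf_union]
    exact setoidEntropy_submod hw (biInf_mono Set.inter_subset_left)
      (biInf_mono Set.inter_subset_right)

theorem isClosed_polymatroids (ι : Type*) : IsClosed (polymatroids ι) := by
  have : polymatroids ι = {h | h ∅ = 0} ∩ {h | ∀ α, 0 ≤ h α} ∩ {h | ∀ α β, β ⊆ α → h β ≤ h α} ∩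
      {h | ∀ α β, h (α ∩ β) + h (α ∪ β) ≤ h α + h β} := by
    ext h
    exact ⟨fun ⟨a, b, c, d⟩ => ⟨⟨⟨a, b⟩, c⟩, d⟩, fun ⟨⟨⟨a, b⟩, c⟩, d⟩ => ⟨a, b, c, d⟩⟩
  rw [this]
  simp only [Set.ofPred_forall]
  refine ((IsClosed.inter ?_ ?_).inter ?_).inter ?_
  · exact isClosed_eq (continuous_apply _) continuous_const
  · exact isClosed_iInter fun α => isClosed_le continuous_const (continuous_apply _)
  · exact isClosed_iInter fun α => isClosed_iInter fun β => isClosed_iInter fun _ =>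
      isClosed_le (continuous_apply _) (continuous_apply _)
  · exact isClosed_iInter fun α => isClosed_iInter fun β =>
      isClosed_le (by fun_prop) (by fun_prop)

theorem almostEntropic_subset_polymatroids (ι : Type*) [Finite ι] :
    almostEntropic ι ⊆ polymatroids ι := by
  refine closure_minimal (fun h hh => ?_) (isClosed_polymatroids ι)
  obtain ⟨Ω, _, w, r, hw, hr⟩ := exists_setoidEntropy_eq hh
  rw [funext hr]
  exact isPolymatroid_setoidEntropy hw r

theorem IsPolymatroid.comp_image {ι κ : Type*} {h : Set κ → ℝ} (hh : IsPolymatroid h) {j : ι → κ}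
    (hj : j.Injective) : IsPolymatroid fun α : Set ι => h (j '' α) where
  empty := by simp [hh.empty]
  nonneg α := hh.nonneg _
  mono α β hab := hh.mono _ _ (Set.image_mono hab)
  submod α β := by
    simp only [Set.image_inter hj, Set.image_union]
    exact hh.submod _ _

/-- Reindexing a family of variables gives a family again, even with repetitions, and reindexing is
continuous, so it passes to closures. -/
theorem comp_image_mem_almostEntropic {ι κ : Type*} [Finite κ] {h : Set κ → ℝ}
    (hh : h ∈ almostEntropic κ) (j : ι → κ) :
    (fun α : Set ι => h (j '' α)) ∈ almostEntropic ι := by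
  refine map_mem_closure (f := fun (h : Set κ → ℝ) (α : Set ι) => h (j '' α))
    (continuous_pi fun α => continuous_apply _) hh fun h hh => ?_
  obtain ⟨Ω, _, w, r, hw, hr⟩ := exists_setoidEntropy_eq hh
  simp only [hr, iInf_image]
  exact setoidEntropy_mem_entropicFunctions hw fun i => r (j i)

end Entropic

/-! ### Independent copies. -/

section Copies

variable {Ω : Type*} [Fintype Ω] {w : Ω → ℝ}

/-- Equality in every coordinate up to `r`. -/
def powSetoid {Ω : Type*} (N : ℕ) (r : Setoid Ω) : Setoid (Fin N → Ω) :=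
  ⨅ n, Setoid.comap (fun y => y n) r

theorem powSetoid_rel {Ω : Type*} {N : ℕ} {r : Setoid Ω} {x y : Fin N → Ω} :
    powSetoid N r x y ↔ ∀ n, r (x n) (y n) :=
  iInf_rel

theorem powSetoid_iInf {Ω ι : Type*} (N : ℕ) (r : ι → Setoid Ω) (α : Set ι) :
    powSetoid N (⨅ i ∈ α, r i) = ⨅ i ∈ α, powSetoid N (r i) := by
  ext x y
  simp only [powSetoid_rel, iInf_rel]
  exact ⟨fun h i hi n => h n i hi, fun h n i hi => h i hi n⟩

theorem powSetoid_bot (Ω : Type*) (N : ℕ) : powSetoid N (⊥ : Setoid Ω) = ⊥ := by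
  ext x y
  rw [powSetoid_rel]
  simp [funext_iff]

theorem isProbWeight_pow (hw : IsProbWeight w) (N : ℕ) :
    IsProbWeight fun y : Fin N → Ω => ∏ n, w (y n) where
  nonneg y := Finset.prod_nonneg fun n _ => hw.nonneg _
  sum_eq := by
    classical
    rw [← Fintype.piFinset_univ, ← Finset.prod_univ_sum]
    simp [hw.sum_eq]

theorem classMass_pow (w : Ω → ℝ) (N : ℕ) (r : Setoid Ω) (y : Fin N → Ω) :
    classMass (fun y : Fin N → Ω => ∏ n, w (y n)) (powSetoid N r) y =
      ∏ n, classMass w r (y n) := by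
  classical
  simp only [classMass]
  rw [Finset.prod_univ_sum, Fintype.piFinset_univ]
  refine Finset.sum_congr rfl fun x _ => ?_
  by_cases h : ∀ n, r (x n) (y n)
  · rw [if_pos (powSetoid_rel.2 h)]
    exact Finset.prod_congr rfl fun n _ => (if_pos (h n)).symm
  · rw [if_neg (mt powSetoid_rel.1 h)]
    push Not at h
    obtain ⟨n, hn⟩ := h
    exact (Finset.prod_eq_zero (Finset.mem_univ n) (if_neg hn)).symm

theorem sum_prod_mul_apply (hw : IsProbWeight w) {N : ℕ} (g : Ω → ℝ) (m : Fin N) :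
    ∑ y : Fin N → Ω, (∏ n, w (y n)) * g (y m) = ∑ ω, w ω * g ω := by
  classical
  -- Absorbing `g` into the factor of coordinate `m` keeps a product form, so the sum factorises and
  -- all other coordinates sum to `1`.
  have h1 : ∀ y : Fin N → Ω, (∏ n, w (y n)) * g (y m) =
      ∏ n, w (y n) * (if n = m then g (y n) else 1) := fun y => by
    rw [Finset.prod_mul_distrib, Finset.prod_ite_eq' Finset.univ m fun n => g (y n)]
    simp
  simp_rw [h1]
  rw [← Fintype.piFinset_univ, ← Finset.prod_univ_sum (fun _ => Finset.univ)
    (fun n ω => w ω * if n = m then g ω else 1),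
    Finset.prod_eq_single m]
  · simp
  · intro n _ hn
    simp [hn, hw.sum_eq]
  · simp

/-- Class masses multiply over the coordinates, so the logarithm splits into `N` terms, each
averaging to the entropy of one copy. -/
theorem setoidEntropy_pow (hw : IsProbWeight w) (N : ℕ) (r : Setoid Ω) :
    setoidEntropy (fun y : Fin N → Ω => ∏ n, w (y n)) (powSetoid N r) =
      N * setoidEntropy w r := by
  have h : ∀ y : Fin N → Ω, (∏ n, w (y n)) * -Real.log (∏ n, classMass w r (y n)) =
      ∑ m, (∏ n, w (y n)) * -Real.log (classMass w r (y m)) := fun y => by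
    by_cases h0 : ∏ n, w (y n) = 0
    · simp [h0]
    · rw [Real.log_prod, ← Finset.sum_neg_distrib, Finset.mul_sum]
      intro n _
      have h1 := Finset.prod_ne_zero_iff.1 h0 n (Finset.mem_univ n)
      exact (((hw.nonneg _).lt_of_ne' h1).trans_le (le_classMass hw.nonneg r _)).ne'
  simp only [setoidEntropy, classMass_pow, h]
  rw [Finset.sum_comm]
  simp only [sum_prod_mul_apply hw fun ω => -Real.log (classMass w r ω)]
  simp

end Copies

/-! ### Scaling an entropy function by a factor at most one. -/

section Mixture

variable {Ω : Type*} [Fintype Ω] {w : Ω → ℝ}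

/-- With probability `t` an outcome drawn from `w`, and otherwise `none`. -/
def mixWeight {Ω : Type*} (t : ℝ) (w : Ω → ℝ) : Option Ω → ℝ
  | none => 1 - t
  | some ω => t * w ω

/-- The equivalence relation `r` on `Ω`, with `none` as an additional class. -/
def optionSetoid {Ω : Type*} (r : Setoid Ω) : Setoid (Option Ω) :=
  Setoid.ker (Option.map (Quotient.mk r))

theorem optionSetoid_rel {Ω : Type*} {r : Setoid Ω} {x y : Option Ω} :
    optionSetoid r x y ↔ x.map (Quotient.mk r) = y.map (Quotient.mk r) := Iff.rfl

theorem optionSetoid_some {Ω : Type*} {r : Setoid Ω} {x y : Ω} :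
    optionSetoid r (some x) (some y) ↔ r x y := by
  simp [optionSetoid_rel, Quotient.eq]

/-- This fails for empty `α`: the empty infimum is `⊤`, which identifies `none` with the other
outcomes. -/
theorem optionSetoid_iInf {Ω ι : Type*} (r : ι → Setoid Ω) {α : Set ι} (hα : α.Nonempty) :
    optionSetoid (⨅ i ∈ α, r i) = ⨅ i ∈ α, optionSetoid (r i) := by
  obtain ⟨j, hj⟩ := hα
  ext x y
  simp only [iInf_rel, optionSetoid_rel]
  rcases x with _ | x <;> rcases y with _ | y
  · simp
  · simpa using ⟨j, hj⟩
  · simpa using ⟨j, hj⟩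
  · simp [Quotient.eq, iInf_rel]

theorem isProbWeight_mix (hw : IsProbWeight w) {t : ℝ} (h0 : 0 ≤ t) (h1 : t ≤ 1) :
    IsProbWeight (mixWeight t w) where
  nonneg
    | none => sub_nonneg.2 h1
    | some ω => mul_nonneg h0 (hw.nonneg ω)
  sum_eq := by
    simp [Fintype.sum_option, mixWeight, ← Finset.mul_sum, hw.sum_eq]

/-- Chain rule: every class reveals whether the outcome is `none`, which contributes the binary
entropy of `t`. -/
theorem setoidEntropy_mix (hw : IsProbWeight w) {t : ℝ} (r : Setoid Ω) :
    setoidEntropy (mixWeight t w) (optionSetoid r) =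
      t * setoidEntropy w r + (Real.negMulLog t + Real.negMulLog (1 - t)) := by
  classical
  have hn : classMass (mixWeight t w) (optionSetoid r) none = 1 - t := by
    simp [classMass, mixWeight, optionSetoid_rel]
  have hs : ∀ ω, classMass (mixWeight t w) (optionSetoid r) (some ω) = t * classMass w r ω := by
    intro ω
    simp only [classMass, Fintype.sum_option, optionSetoid_some, mixWeight, Finset.mul_sum]
    simp [optionSetoid_rel]
  have h : ∀ ω, t * w ω * -Real.log (t * classMass w r ω) =
      w ω * Real.negMulLog t + t * (w ω * -Real.log (classMass w r ω)) := fun ω => by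
    rcases eq_or_ne t 0 with rfl | ht
    · simp
    rcases (hw.nonneg ω).eq_or_lt with h0 | h0
    · simp [← h0]
    · rw [Real.log_mul ht (h0.trans_le (le_classMass hw.nonneg r ω)).ne', Real.negMulLog]
      ring
  rw [setoidEntropy, Fintype.sum_option, hn]
  simp only [hs, mixWeight, h, Finset.sum_add_distrib, ← Finset.sum_mul, hw.sum_eq,
    ← Finset.mul_sum]
  simp only [setoidEntropy, Real.negMulLog]
  ring

/-- Reveal `k + 1` independent copies with probability `c / (k + 1)`, and nothing otherwise. The
entropy is `c` times the original plus the binary entropy of `c / (k + 1)`, which vanishes as `k →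
∞`. -/
theorem smul_setoidEntropy_mem_almostEntropic {ι : Type*} (hw : IsProbWeight w)
    (r : ι → Setoid Ω) {c : ℝ} (hc : 0 ≤ c) (hc1 : c ≤ 1) :
    (fun α : Set ι => c * setoidEntropy w (⨅ i ∈ α, r i)) ∈ almostEntropic ι := by
  have ht : Tendsto (fun k : ℕ => c / (k + 1 : ℝ)) atTop (𝓝 0) := by
    simpa [div_eq_mul_inv] using
      (tendsto_one_div_add_atTop_nhds_zero_nat (𝕜 := ℝ)).const_mul c
  refine mem_closure_of_tendsto (f := fun (k : ℕ) (α : Set ι) =>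
    setoidEntropy (mixWeight (c / (k + 1 : ℝ)) fun y : Fin (k + 1) → Ω => ∏ n, w (y n))
      (⨅ i ∈ α, optionSetoid (powSetoid (k + 1) (r i)))) (b := atTop) ?_
      (Eventually.of_forall fun k => ?_)
  · rw [tendsto_pi_nhds]
    intro α
    rcases α.eq_empty_or_nonempty with rfl | hα
    · have : ∀ k : ℕ, IsProbWeight (mixWeight (c / (k + 1 : ℝ))
          fun y : Fin (k + 1) → Ω => ∏ n, w (y n)) := fun k =>
        isProbWeight_mix (isProbWeight_pow hw _) (by positivity)
          ((div_le_one (by positivity)).2 (hc1.trans (by simp)))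
      simp [setoidEntropy_top hw, setoidEntropy_top (this _)]
    · have h1 : ∀ k : ℕ, setoidEntropy (mixWeight (c / (k + 1 : ℝ))
          fun y : Fin (k + 1) → Ω => ∏ n, w (y n))
          (⨅ i ∈ α, optionSetoid (powSetoid (k + 1) (r i))) =
          c * setoidEntropy w (⨅ i ∈ α, r i) +
          (Real.negMulLog (c / (k + 1 : ℝ)) + Real.negMulLog (1 - c / (k + 1 : ℝ))) := fun k => by
        rw [← optionSetoid_iInf _ hα, setoidEntropy_mix (isProbWeight_pow hw _),
          ← powSetoid_iInf, setoidEntropy_pow hw]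
        push_cast
        field_simp
      simp_rw [h1]
      have h2 := (Real.continuous_negMulLog.tendsto 0).comp ht
      have h3 := (Real.continuous_negMulLog.tendsto (1 - 0)).comp (ht.const_sub 1)
      simpa using (h2.add h3).const_add (c * setoidEntropy w (⨅ i ∈ α, r i))
  · exact setoidEntropy_mem_entropicFunctions (isProbWeight_mix (isProbWeight_pow hw _)
      (by positivity) ((div_le_one (by positivity)).2 (hc1.trans (by simp)))) _

end Mixture

instance {X : Type*} [Finite X] (T : Set X) : Finite (BinPartition T) :=
  inferInstanceAs (Finite {P : Set (Set X) //
    ∃ α ⊆ T, α.Nonempty ∧ (T \ α).Nonempty ∧ P = {α, T \ α}})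

/-! ### Functional dependence within a network code. -/

section Code

variable {V E S : Type*} [Finite E] {G : Network V E S} {𝒴 : S → Type*} {N : ℕ}

/-- The information carried by the block of a source, by the message on an edge and by the
block of a binary partition variable, as equivalence relations on the blocks. -/
def NetworkCode.setoid (φ : NetworkCode G 𝒴 N) (T : Set (∀ s, 𝒴 s)) :
    S ⊕ E ⊕ BinPartition T → Setoid (Fin N → ∀ s, 𝒴 s)
  | .inl s => Setoid.ker fun y n => y n s
  | .inr (.inl e) => Setoid.ker fun y => φ.msg y e
  | .inr (.inr P) => Setoid.ker fun y n => partitionVar P (y n)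

variable (φ : NetworkCode G 𝒴 N) (T : Set (∀ s, 𝒴 s))

theorem NetworkCode.setoid_atNode_rel (u : V) {x y : Fin N → ∀ s, 𝒴 s}
    (h : (⨅ i ∈ Sum.inl '' G.srcAt u ∪ (Sum.inr ∘ Sum.inl) '' G.inEdges u, φ.setoid T i) x y) :
    (fun (s : G.srcAt u) n => x n s) = (fun (s : G.srcAt u) n => y n s) ∧
      (fun f : G.inEdges u => φ.msg x f) = fun f : G.inEdges u => φ.msg y f := by
  simp only [iInf_rel] at h
  exact ⟨funext fun s => h (.inl s) (Or.inl ⟨s, s.2, rfl⟩),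
    funext fun f => h (.inr (.inl f)) (Or.inr ⟨f, f.2, rfl⟩)⟩

theorem NetworkCode.setoid_atNode_le_msg (e : E) :
    (⨅ i ∈ Sum.inl '' G.srcAt (G.tail e) ∪ (Sum.inr ∘ Sum.inl) '' G.inEdges (G.tail e),
      φ.setoid T i) ≤ φ.setoid T (.inr (.inl e)) := by
  intro x y h
  obtain ⟨h1, h2⟩ := φ.setoid_atNode_rel T _ h
  change φ.msg x e = φ.msg y e
  rw [φ.msg_eq, φ.msg_eq]
  exact congrArg₂ (φ.enc e) h1 h2

theorem NetworkCode.setoid_atNode_le_decoded (s : S) (u : V) (hu : u ∈ G.b s) :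
    (⨅ i ∈ Sum.inl '' G.srcAt u ∪ (Sum.inr ∘ Sum.inl) '' G.inEdges u, φ.setoid T i) ≤
      Setoid.ker fun y => φ.decoded y s u hu := by
  intro x y h
  obtain ⟨h1, h2⟩ := φ.setoid_atNode_rel T _ h
  exact congrArg₂ (φ.dec s u hu) h1 h2

/-- Each of these variables acts letter by letter, so the quantifiers over variables and over time
commute. -/
theorem NetworkCode.setoid_sources (α : Set S) (β : Set (BinPartition T)) :
    (⨅ i ∈ Sum.inl '' α ∪ (Sum.inr ∘ Sum.inr) '' β, φ.setoid T i) =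
      powSetoid N (Setoid.ker fun y =>
        ((fun s : α => y s), (fun P : β => partitionVar P.1 y))) := by
  ext x y
  simp only [iInf_rel, powSetoid_rel, Setoid.ker_def, Prod.mk.injEq, funext_iff, Subtype.forall]
  constructor
  · intro h n
    exact ⟨fun s hs => congrFun (h (.inl s) (Or.inl ⟨s, hs, rfl⟩)) n,
      fun P hP => congrFun (h (.inr (.inr P)) (Or.inr ⟨P, hP, rfl⟩)) n⟩
  · rintro h _ (⟨s, hs, rfl⟩ | ⟨P, hP, rfl⟩)
    · exact funext fun n => (h n).1 s hs
    · exact funext fun n => (h n).2 P hP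

end Code

/-! ### The converse, by compactness of normalised entropy functions. -/

section Converse

variable {V E S : Type*} [Finite E] [Finite S] {G : Network V E S}
  {𝒴 : S → Type*} [∀ s, Finite (𝒴 s)] {p : PMF (∀ s, 𝒴 s)}

theorem errorProb_toReal [Fintype (∀ s, 𝒴 s)] {N : ℕ} (φ : NetworkCode G 𝒴 N) (s : S) (u : V)
    (hu : u ∈ G.b s) : (errorProb G p φ s u hu).toReal =
      ∑ y, {y | φ.decoded y s u hu ≠ fun n => y n s}.indicator
        (fun y => ∏ n, (p (y n)).toReal) y := by
  have hl : ∀ y, (iidLaw p N) y = ∏ n, p (y n) := fun y => rfl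
  rw [errorProb, PMF.toOuterMeasure_apply_fintype, ENNReal.toReal_sum]
  · refine Finset.sum_congr rfl fun y _ => ?_
    by_cases h : φ.decoded y s u hu = fun n => y n s
    · simp [h]
    · rw [Set.indicator_of_mem (by exact h), Set.indicator_of_mem (by exact h), hl,
        ENNReal.toReal_prod]
  · intro y _
    exact ne_top_of_le_ne_top ((iidLaw p N).apply_ne_top y)
      (Set.indicator_le_self _ _ _)

theorem isCompact_setFunctions (ι : Type*) (M : ℝ) :
    IsCompact {h : Set ι → ℝ | ∀ α, h α ∈ Set.Icc 0 M} := by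
  simpa [Set.pi] using isCompact_univ_pi fun _ : Set ι => isCompact_Icc (a := (0 : ℝ)) (b := M)

theorem achievableRegion_subset_partitionRegion :
    achievableRegion G p ⊆ partitionRegion G p (almostEntropic _) := by
  classical
  rintro C ⟨φ, hrate, herr⟩
  have := Fintype.ofFinite (∀ s, 𝒴 s)
  have hw := isProbWeight_toReal p
  set w : (∀ s, 𝒴 s) → ℝ := fun y => (p y).toReal with hwdef
  have hpow := isProbWeight_pow hw
  let r := fun N => (φ N).setoid p.support
  let H : (N : ℕ) → Set (S ⊕ E ⊕ BinPartition p.support) → ℝ := fun N α =>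
    setoidEntropy (fun y : Fin N → ∀ s, 𝒴 s => ∏ n, w (y n)) (⨅ i ∈ α, r N i)
  -- Since `0⁻¹ = 0`, the function `g 0` vanishes. It violates the source constraints in general,
  -- which is why `N > 0` is required when these are checked.
  let g : (N : ℕ) → Set (S ⊕ E ⊕ BinPartition p.support) → ℝ := fun N α => (N : ℝ)⁻¹ * H N α
  have hinv : ∀ N : ℕ, (0 : ℝ) ≤ (N : ℝ)⁻¹ := fun N => by positivity
  have hmem : ∀ N, g N ∈ almostEntropic _ := fun N =>
    smul_setoidEntropy_mem_almostEntropic (hpow N) (r N) (hinv N) (Nat.cast_inv_le_one N)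
  have hbd : ∀ N α, g N α ∈ Set.Icc 0 (setoidEntropy w ⊥) := fun N α => by
    refine ⟨mul_nonneg (hinv N) (setoidEntropy_nonneg (hpow N) _), ?_⟩
    have h1 : H N α ≤ N * setoidEntropy w ⊥ := by
      rw [← setoidEntropy_pow hw, powSetoid_bot]
      exact setoidEntropy_anti (hpow N).nonneg bot_le
    refine (mul_le_mul_of_nonneg_left h1 (hinv N)).trans ?_
    rw [← mul_assoc]
    exact mul_le_of_le_one_left (setoidEntropy_nonneg hw _) inv_mul_le_one
  obtain ⟨h, -, ψ, hψ, hlim⟩ := (isCompact_setFunctions _ _).tendsto_subseq hbd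
  have hlim' : ∀ α, Tendsto (fun k => g (ψ k) α) atTop (𝓝 (h α)) := fun α =>
    (tendsto_pi_nhds.1 hlim) α
  have hcond : ∀ α β, Tendsto (fun k => condVal (g (ψ k)) α β) atTop (𝓝 (condVal h α β)) :=
    fun α β => (hlim' _).sub (hlim' _)
  have hψt := hψ.tendsto_atTop
  refine ⟨h, isClosed_closure.mem_of_tendsto hlim (Eventually.of_forall fun k => hmem _), ?_, ?_, ?_, ?_⟩
  · intro α β
    rw [entropy_map_eq, sub_eq_zero]
    refine tendsto_nhds_unique (hlim' _) (tendsto_const_nhds.congr' ?_)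
    filter_upwards [hψt.eventually_gt_atTop 0] with k hk
    have hk' : (0 : ℝ) < ψ k := by exact_mod_cast hk
    simp only [g, H, r]
    rw [NetworkCode.setoid_sources, setoidEntropy_pow hw, inv_mul_cancel_left₀ hk'.ne']
  · intro e
    refine tendsto_nhds_unique (hcond _ _) (tendsto_const_nhds.congr fun k => ?_)
    simp only [condVal, g, H, r]
    rw [iInf_union, iInf_singleton, Function.comp_apply,
      inf_eq_right.2 ((φ (ψ k)).setoid_atNode_le_msg _ e), sub_self]
  · intro s u hu
    refine le_antisymm ?_ ?_
    · have := Fintype.ofFinite (𝒴 s)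
      -- This is Fano's bound divided by `N`: the block alphabet has size `|𝒴 s| ^ N`, so the error
      -- probability keeps the fixed factor `log |𝒴 s|`.
      have hu1 : Tendsto (fun N : ℕ => (N : ℝ)⁻¹ * Real.log 2 +
          (errorProb G p (φ N) s u hu).toReal * Real.log (Fintype.card (𝒴 s))) atTop (𝓝 0) := by
        have h1 := (tendsto_inv_atTop_nhds_zero_nat (𝕜 := ℝ)).mul_const (Real.log 2)
        have h2 := ((ENNReal.tendsto_toReal ENNReal.zero_ne_top).comp (herr s u hu)).mul_const
          (Real.log (Fintype.card (𝒴 s)))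
        simpa using h1.add h2
      refine le_of_tendsto_of_tendsto (hcond _ _) (hu1.comp hψt) ?_
      filter_upwards [hψt.eventually_gt_atTop 0] with k hk
      have hk' : (0 : ℝ) < ψ k := by exact_mod_cast hk
      have hf := fano (hpow (ψ k)) (fun y n => y n s) (fun y => (φ (ψ k)).decoded y s u hu) _
        ((φ (ψ k)).setoid_atNode_le_decoded p.support s u hu)
      rw [hwdef, ← errorProb_toReal, Fintype.card_fun, Fintype.card_fin] at hf
      simp only [condVal, g, H, Function.comp_apply]
      rw [iInf_union, iInf_singleton, ← mul_sub]
      refine (mul_le_mul_of_nonneg_left hf (hinv _)).trans (le_of_eq ?_)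
      push_cast
      rw [Real.log_pow]
      field_simp
    · refine ge_of_tendsto' (hcond _ _) fun k => sub_nonneg.2 ?_
      exact mul_le_mul_of_nonneg_left (setoidEntropy_anti (hpow _).nonneg
        (biInf_mono Set.subset_union_right)) (hinv _)
  · intro e
    obtain ⟨ρ, hρ, hρC⟩ := hrate e
    refine (le_of_tendsto_of_tendsto' (hlim' _) (hρ.comp hψt) fun k => ?_).trans hρC
    simp only [g, H, Function.comp_apply]
    rw [iInf_singleton, div_eq_inv_mul]
    refine mul_le_mul_of_nonneg_left ?_ (hinv _)
    have := setoidEntropy_ker_le_log_card (hpow (ψ k)) fun y => (φ (ψ k)).msg y e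
    rwa [Fintype.card_fin] at this

end Converse

/-! ### Comparison of the outer bounds. -/

section Regions

variable {V E S : Type*} {G : Network V E S} {𝒴 : S → Type*} {p : PMF (∀ s, 𝒴 s)}

theorem outerRegion_mono {Δ Δ' : Set (Set (S ⊕ E) → ℝ)} (h : Δ ⊆ Δ') :
    outerRegion G p Δ ⊆ outerRegion G p Δ' :=
  fun _ ⟨f, hf, hc⟩ => ⟨f, h hf, hc⟩

theorem partitionRegion_mono {Δ Δ' : Set (Set (S ⊕ E ⊕ BinPartition p.support) → ℝ)}
    (h : Δ ⊆ Δ') : partitionRegion G p Δ ⊆ partitionRegion G p Δ' :=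
  fun _ ⟨f, hf, hc⟩ => ⟨f, h hf, hc⟩

theorem partitionRegion_subset_outerRegion [Finite S] [∀ s, Finite (𝒴 s)]
    {Δ' : Set (Set (S ⊕ E ⊕ BinPartition p.support) → ℝ)} {Δ : Set (Set (S ⊕ E) → ℝ)}
    (hΔ : ∀ h ∈ Δ', (fun α : Set (S ⊕ E) => h (Sum.map id Sum.inl '' α)) ∈ Δ) :
    partitionRegion G p Δ' ⊆ outerRegion G p Δ := by
  have := Fintype.ofFinite (∀ s, 𝒴 s)
  have hsrc : ∀ α : Set S, (Sum.map id Sum.inl : S ⊕ E → S ⊕ E ⊕ BinPartition p.support) ''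
      (Sum.inl '' α) = Sum.inl '' α := fun α => by simp [Set.image_image]
  have hlnk : ∀ α : Set E, (Sum.map id Sum.inl : S ⊕ E → S ⊕ E ⊕ BinPartition p.support) ''
      (Sum.inr '' α) = (Sum.inr ∘ Sum.inl) '' α := fun α => by simp [Set.image_image]
  rintro C ⟨h, hh, hs, hc⟩
  refine ⟨_, hΔ h hh, fun α => ?_, fun e => ?_, fun s u hu => ?_, fun e => ?_⟩
  -- With no partition variables, the second component of the pair is the empty tuple and leaves the
  -- kernel unchanged.
  · have h1 := hs α ∅
    rw [Set.image_empty, Set.union_empty] at h1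
    rw [hsrc, ← h1, entropy_map_eq, entropy_map_eq]
    congr 2
    ext x y
    simp [Setoid.ker_def, funext_iff]
  · have := hc.encoding e
    simpa only [condVal, Set.image_union, hsrc, hlnk, Set.image_singleton, Sum.map_inr,
      Function.comp_apply] using this
  · have := hc.decoding s u hu
    simpa only [condVal, Set.image_union, hsrc, hlnk, Set.image_singleton, Sum.map_inl, id,
      Function.comp_apply] using this
  · simpa only [Set.image_singleton, Sum.map_inr, Function.comp_apply] using hc.capacity e

end Regions

end

end CorrelatedSources

open CorrelatedSources in
theorem mainTheorem5 {V E S : Type*} [Finite V] [Finite E] [Finite S] (G : Network V E S)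
    {𝒴 : S → Type*} [∀ s, Finite (𝒴 s)] (p : PMF (∀ s, 𝒴 s)) :
    (achievableRegion G p ⊆ partitionRegion G p (almostEntropic _) ∧
      partitionRegion G p (almostEntropic _) ⊆ outerRegion G p (almostEntropic _) ∧
      outerRegion G p (almostEntropic _) ⊆ outerRegion G p (polymatroids _)) ∧
    (achievableRegion G p ⊆ partitionRegion G p (polymatroids _) ∧
      partitionRegion G p (polymatroids _) ⊆ outerRegion G p (polymatroids _)) := by
  refine ⟨⟨achievableRegion_subset_partitionRegion, ?_, ?_⟩, ?_, ?_⟩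
  · exact partitionRegion_subset_outerRegion fun h hh => comp_image_mem_almostEntropic hh _
  · exact outerRegion_mono (almostEntropic_subset_polymatroids _)
  · exact achievableRegion_subset_partitionRegion.trans
      (partitionRegion_mono (almostEntropic_subset_polymatroids _))
  · exact partitionRegion_subset_outerRegion fun h hh =>
      IsPolymatroid.comp_image hh (Function.injective_id.sumMap Sum.inl_injective)
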